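/- Let $K,d,S,N$ be positive integers with $S+2\le N\le d(K-1)+S$, and let $w\in\mathbb{C}^K$ with $w_k\ne 0$ for all $k$. Write $[m]=\{0,\dots,m-1\}$. A non-straggler pattern is a nonempty collection $\boldsymbol{\mathcal N}=\{\mathcal N_g: g\in[G]\}$ of subsets of $[N]$ with $|\mathcal N_g|=N-S$. Put $\mathcal I=\bigcap_g\mathcal N_g$, $I=|\mathcal I|$, $L=N-S-I$, $C=d(K-1)+S+1-N$, and let $I^*=\lfloor (K-1)/2\rfloor+1$ if $d=1$ and $I^*=(d-1)(K-1)+1$ if $d\ge2$. Given distinct data points $\alpha_k\in\mathbb{C}$ ($k\in[K]$) and distinct evaluation points $\beta_n\in\mathbb{C}$ ($n\in[N]$) with $\{\alpha_k\}\cap\{\beta_n\}=\emptyset$, the coded polynomial aggregation scheme works as follows. For data matrices $X_0,\dots,X_{K-1}\in\mathbb{C}^{q\times v}$ and a polynomial $F$ of degree $d$ acting entrywise, let $E$ be the matrix polynomial of degree at most $K-1$ with $E(\alpha_k)=X_k$ for all $k$. For $\mathcal N\in\boldsymbol{\mathcal N}$, let $D$ be the matrix polynomial of degree at most $N-S-1$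 with $D(\beta_n)=F(E(\beta_n))$ for $n\in\mathcal N$. The scheme is feasible over $\boldsymbol{\mathcal N}$ if $\sum_k w_kD(\alpha_k)=\sum_k w_kF(X_k)$ for all $q,v$, all $X_0,\dots,X_{K-1}$, all $F$ of degree $d$ and all $\mathcal N\in\boldsymbol{\mathcal N}$. Then there is a proper algebraic subvariety of $\mathbb{C}^K$, depending only on $K,N,d,S,w$, such that the following holds for every non-straggler pattern $\boldsymbol{\mathcal N}$ with $I\ge I^*$ and all pairwise distinct data points $(\alpha_k)_{k\in[K]}$ outside this variety. Let $U=V\operatorname{diag}(w)A$, where $V=(\alpha_k^j)_{j\in[C+L],\,k\in[K]}$ and $A=(\alpha_k^n)_{k\in[K],\,n\in[I+1]}$. For $c\in\mathbb{C}^{I+1}$ put $P_{\mathrm{form}}(z)=\sum_{n=0}^I c_nz^n$. 1. For generic $c\in\ker U$ (all $c \in \ker U$ outside the zero set of some polynomial that does not vanish identically on $\ker U$), $c$ is nonzero and $P_{\mathrm{form}}$ has exactly $I$ distinct roots, none of which is a data point. In particular, such a $c$ exists. 2. Let $c\in\ker U$ be any nonzero vector for which $P_{\mathrm{form}}$ has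 exactly $I$ distinct roots, none of which is a data point. Let $\{\beta_n:n\in\mathcal I\}$ be the set of these roots, and choose the remaining values $\beta_n$, $n\in[N]\setminus\mathcal I$, arbitrarily subject to being distinct from each other, from these roots and from all $\alpha_k$. Such choices exist, and for every such choice the resulting scheme is feasible over $\boldsymbol{\mathcal N}$. -/

import Mathlib

open Polynomial

noncomputable section

/-- A non-straggler pattern on the workers `Fin N`: a nonempty collection of subsets of size `N - S`. -/
structure NonStragglerPattern (N S : ℕ) where
  sets : Finset (Finset (Fin N))
  nonempty : sets.Nonempty
  card_eq : ∀ T ∈ sets, T.card = N - S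

namespace NonStragglerPattern

variable {N S : ℕ} (𝒩 : NonStragglerPattern N S)

/-- The intersection of all non-straggler sets. -/
def inter : Finset (Fin N) := Finset.univ.filter fun n => ∀ T ∈ 𝒩.sets, n ∈ T

/-- The size `I` of the intersection. -/
def interCard : ℕ := 𝒩.inter.card

/-- `L = N - S - I`. -/
def gap : ℕ := N - S - 𝒩.interCard

end NonStragglerPattern

/-- `C = d (K - 1) + S + 1 - N`. -/
def deficit (K d S N : ℕ) : ℕ := d * (K - 1) + S + 1 - N

/-- The sufficient threshold `I*`. -/
def sufficientThreshold (K d : ℕ) : ℕ :=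
  if d = 1 then (K - 1) / 2 + 1 else (d - 1) * (K - 1) + 1

section Scheme

variable {K N q v : ℕ}

/-- The encoder polynomial `E(z)`, a matrix of polynomials of degree at most `K - 1` with
`E(α k) = X k`. -/
def encoder (α : Fin K → ℂ) (X : Fin K → Matrix (Fin q) (Fin v) ℂ) :
    Matrix (Fin q) (Fin v) ℂ[X] :=
  Matrix.of fun a b => Lagrange.interpolate Finset.univ α fun k => X k a b

/-- The result `F(E(β n))` returned by worker `n`, with `F` acting entrywise. -/
def response (F : ℂ[X]) (α : Fin K → ℂ) (β : Fin N → ℂ)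
    (X : Fin K → Matrix (Fin q) (Fin v) ℂ) (n : Fin N) : Matrix (Fin q) (Fin v) ℂ :=
  ((encoder α X).map fun p => p.eval (β n)).map fun x => F.eval x

/-- The decoder polynomial `D(z)`, a matrix of polynomials of degree at most `|T| - 1` that
interpolates the responses of the workers in `T`. -/
def decoder (F : ℂ[X]) (α : Fin K → ℂ) (β : Fin N → ℂ)
    (X : Fin K → Matrix (Fin q) (Fin v) ℂ) (T : Finset (Fin N)) :
    Matrix (Fin q) (Fin v) ℂ[X] :=
  Matrix.of fun a b => Lagrange.interpolate T β fun n => response F α β X n a b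

/-- The decoded output `∑ k, w k D(α k)`. -/
def decodedOutput (F : ℂ[X]) (w α : Fin K → ℂ) (β : Fin N → ℂ)
    (X : Fin K → Matrix (Fin q) (Fin v) ℂ) (T : Finset (Fin N)) : Matrix (Fin q) (Fin v) ℂ :=
  ∑ k, w k • (decoder F α β X T).map fun p => p.eval (α k)

/-- The desired aggregation `∑ k, w k F(X k)`. -/
def aggregation (F : ℂ[X]) (w : Fin K → ℂ) (X : Fin K → Matrix (Fin q) (Fin v) ℂ) :
    Matrix (Fin q) (Fin v) ℂ :=
  ∑ k, w k • (X k).map fun x => F.eval x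

/-- The scheme with data points `α` and evaluation points `β` is feasible over `𝒩`: the points
are admissible, and for all data matrices, all polynomials `F` of degree `d`, and
all non-straggler sets, the decoded output is the desired aggregation. -/
structure IsFeasible {S : ℕ} (d : ℕ) (w α : Fin K → ℂ) (β : Fin N → ℂ)
    (𝒩 : NonStragglerPattern N S) : Prop where
  data_injective : Function.Injective α
  eval_injective : Function.Injective β
  disjoint : ∀ k n, α k ≠ β n
  recovery : ∀ (q v : ℕ) (X : Fin K → Matrix (Fin q) (Fin v) ℂ) (F : ℂ[X]), F.natDegree = d →
    ∀ T ∈ 𝒩.sets, decodedOutput F w α β X T = aggregation F w X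

end Scheme

section Construction

variable {K : ℕ}

/-- The `m × K` matrix with entries `α k ^ j`. -/
def powerMatrix (m : ℕ) (α : Fin K → ℂ) : Matrix (Fin m) (Fin K) ℂ :=
  Matrix.of fun j k => α k ^ (j : ℕ)

/-- `U = V diag(w) A`, where `V` is the `m × K` matrix `(α k ^ j)` and `A` is the
`K × (I + 1)` matrix `(α k ^ n)`. -/
def constructionMatrix (m I : ℕ) (w α : Fin K → ℂ) : Matrix (Fin m) (Fin (I + 1)) ℂ :=
  powerMatrix m α * Matrix.diagonal w * (powerMatrix (I + 1) α).transpose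

/-- `P_form(z) = ∑_{n = 0}^{I} c_n z^n`. -/
def formPoly {I : ℕ} (c : Fin (I + 1) → ℂ) : ℂ[X] :=
  ∑ n : Fin (I + 1), Polynomial.C (c n) * Polynomial.X ^ (n : ℕ)

/-- `P_form` has exactly `I` distinct roots, none of which is a data point, so that its roots can
serve as the evaluation points indexed by the intersection. -/
def HasAdmissibleRoots {I : ℕ} (α : Fin K → ℂ) (c : Fin (I + 1) → ℂ) : Prop :=
  {z : ℂ | (formPoly c).IsRoot z}.ncard = I ∧ ∀ k, ¬ (formPoly c).IsRoot (α k)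

/-- `β` is an outcome of the construction from the vector `c`: the values of `β` on the
intersection are the roots of `P_form`, and the other values of `β` are distinct from
each other, from these roots and from the data points, and otherwise arbitrary. -/
structure IsConstructedFrom {N S : ℕ} (𝒩 : NonStragglerPattern N S) (α : Fin K → ℂ)
    (c : Fin (𝒩.interCard + 1) → ℂ) (β : Fin N → ℂ) : Prop where
  roots : β '' (𝒩.inter : Set (Fin N)) = {z : ℂ | (formPoly c).IsRoot z}
  rest_injOn : Set.InjOn β {n | n ∉ 𝒩.inter}
  rest_ne_root : ∀ n ∉ 𝒩.inter, ¬ (formPoly c).IsRoot (β n)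
  rest_ne_data : ∀ n ∉ 𝒩.inter, ∀ k, β n ≠ α k

end Construction

end

/-!
A vector `c` lies in the kernel of `U = V diag(w) A` exactly when the polynomial `P = P_form` is
orthogonal, for the functional `f ↦ ∑ k, w k * f (α k)`, to all polynomials of degree less than
`m = C + L = d (K - 1) + 1 - I`. Everything follows from this reformulation
(`sum_mul_eval_eq_zero_of_mulVec_eq_zero`).

*Feasibility.* For a non-straggler set `T`, the error `F(E(z)) - D(z)` is divisible by the nodal
polynomial of the points `β n`, `n ∈ T`, hence by `P`, whose roots are the points of the
intersection. The cofactor has degree less than `m`, so the weighted sum of the error over the data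
points vanishes (`IsConstructedFrom.sum_mul_eval_interpolate_eq`).

*Genericity.* For a fixed size `I`, admissibility of the roots is the nonvanishing of two
polynomials in `c`: one, built from a resultant, says that `P` is separable of degree `I`, and the
other is the product of the values `P(α k)`. It suffices that each is nonzero somewhere on the
kernel, since a line in the kernel then carries a point where both are
(`exists_mulVec_eq_zero_eval_mul_ne_zero`). For generic data points this can be checked at special
points: where `U` has full row rank, a kernel vector extends to one that is polynomial in the data
points (`exists_polynomial_mulVec_eq_zero`), and the condition on it cuts out a proper hypersurface.

The special points are obtained by letting data points collide. Collapsing a group of points whose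
weights have nonzero sum leaves a functional with `r` atoms of nonzero weight, for any `r` between
`2` and `K` (`exists_hasAtoms_card_eq`). Its matrix has full row rank if `m ≤ r ≤ I + 1`. With
`r = min K I` atoms the kernel contains a product of `I` distinct linear factors vanishing at all
atoms (`HasAtoms.exists_separabilityForm_ne_zero`); with `r = min K (I + 1)` atoms it contains a
polynomial nonzero at all atoms, because the weights of the divided difference are all nonzero and
annihilate degrees less than `r - 1` (`HasAtoms.exists_eval_ne_zero`). The threshold on `I` gives
`m ≤ I` and `m < K`, which is what both choices need.
-/

/-! ### Coefficient vectors and moment matrices -/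

section Moments

variable {R : Type*} [CommRing R] {R' : Type*} [CommRing R'] {K m I : ℕ}

/-- The polynomial `∑ n, c n * X ^ n` with coefficient vector `c`, over any commutative ring. Over
`ℂ` this is `formPoly c`. -/
noncomputable def vectorPoly (c : Fin (I + 1) → R) : R[X] :=
  ∑ n : Fin (I + 1), C (c n) * X ^ (n : ℕ)

/-- The `m × (I + 1)` Hankel matrix of the moments `∑ k, w k * α k ^ (j + n)`. Over `ℂ` this is
`constructionMatrix m I w α`. -/
def momentMatrix (m I : ℕ) (w α : Fin K → R) : Matrix (Fin m) (Fin (I + 1)) R :=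
  Matrix.of fun j n => ∑ k, w k * α k ^ ((j : ℕ) + (n : ℕ))

theorem vectorPoly_eq_formPoly (c : Fin (I + 1) → ℂ) : vectorPoly c = formPoly c := rfl

theorem momentMatrix_eq_constructionMatrix (w α : Fin K → ℂ) :
    momentMatrix m I w α = constructionMatrix m I w α := by
  ext j n
  rw [constructionMatrix, Matrix.mul_apply]
  simp only [Matrix.mul_diagonal, momentMatrix, powerMatrix, Matrix.of_apply,
    Matrix.transpose_apply]
  exact Finset.sum_congr rfl fun k _ => by rw [pow_add]; ring

theorem eval_vectorPoly (c : Fin (I + 1) → R) (x : R) :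
    (vectorPoly c).eval x = ∑ n : Fin (I + 1), c n * x ^ (n : ℕ) := by
  simp [vectorPoly, eval_finsetSum]

theorem map_vectorPoly (φ : R →+* R') (c : Fin (I + 1) → R) :
    (vectorPoly c).map φ = vectorPoly fun n => φ (c n) := by
  simp [vectorPoly, Polynomial.map_sum]

theorem natDegree_vectorPoly_le (c : Fin (I + 1) → R) : (vectorPoly c).natDegree ≤ I :=
  natDegree_sum_le_of_forall_le _ _ fun n _ =>
    (natDegree_C_mul_X_pow_le _ _).trans (Nat.lt_succ_iff.mp n.2)

theorem vectorPoly_coeff {p : R[X]} (hp : p.natDegree ≤ I) :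
    vectorPoly (fun n : Fin (I + 1) => p.coeff n) = p := by
  rw [vectorPoly, Fin.sum_univ_eq_sum_range (fun n => C (p.coeff n) * X ^ n) (I + 1)]
  exact (as_sum_range_C_mul_X_pow' p (Nat.lt_succ_iff.mpr hp)).symm

theorem momentMatrix_mulVec_apply (w α : Fin K → R) (c : Fin (I + 1) → R) (j : Fin m) :
    (momentMatrix m I w α).mulVec c j =
      ∑ k, w k * (α k ^ (j : ℕ) * (vectorPoly c).eval (α k)) := by
  simp only [Matrix.mulVec, dotProduct, momentMatrix, Matrix.of_apply, eval_vectorPoly,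
    Finset.sum_mul, Finset.mul_sum]
  rw [Finset.sum_comm]
  exact Finset.sum_congr rfl fun k _ => Finset.sum_congr rfl fun n _ => by rw [pow_add]; ring

theorem map_momentMatrix (φ : R →+* R') (w α : Fin K → R) :
    (momentMatrix m I w α).map φ =
      momentMatrix m I (fun k => φ (w k)) (fun k => φ (α k)) := by
  ext j n
  simp [momentMatrix]

/-- A vector in the kernel of the moment matrix is a polynomial `P` orthogonal, for the functional
`f ↦ ∑ k, w k * f (α k)`, to all polynomials of degree less than `m`. -/
theorem sum_mul_eval_eq_zero_of_mulVec_eq_zero {w α : Fin K → R} {c : Fin (I + 1) → R}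
    (hc : (momentMatrix m I w α).mulVec c = 0) {Q : R[X]} (hQ : Q.degree < m) :
    ∑ k, w k * (Q * vectorPoly c).eval (α k) = 0 := by
  have hexp : ∀ x, Q.eval x = ∑ j : Fin m, Q.coeff j * x ^ (j : ℕ) := by
    intro x
    rcases eq_or_ne Q 0 with rfl | h0
    · simp
    · rw [Fin.sum_univ_eq_sum_range (fun j => Q.coeff j * x ^ j) m]
      exact eval_eq_sum_range' ((natDegree_lt_iff_degree_lt h0).mpr hQ) x
  calc ∑ k, w k * (Q * vectorPoly c).eval (α k)
      = ∑ j : Fin m, Q.coeff j * (momentMatrix m I w α).mulVec c j := by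
        simp only [momentMatrix_mulVec_apply, eval_mul, hexp, Finset.sum_mul, Finset.mul_sum]
        rw [Finset.sum_comm]
        exact Finset.sum_congr rfl fun j _ => Finset.sum_congr rfl fun k _ => by ring
    _ = 0 := by simp [hc]

end Moments

/-! ### Separability of a polynomial with given coefficients -/

section Separability

variable {R : Type*} [CommRing R] {R' : Type*} [CommRing R'] {I : ℕ}

/-- The formal leading coefficient of `vectorPoly c` times the resultant of `vectorPoly c` and its
derivative, taken in the formal degrees `I` and `I - 1` so that it is a polynomial in `c`. -/
noncomputable def separabilityForm (c : Fin (I + 1) → R) : R :=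
  c (Fin.last I) * resultant (vectorPoly c) (derivative (vectorPoly c)) I (I - 1)

theorem map_separabilityForm (φ : R →+* R') (c : Fin (I + 1) → R) :
    φ (separabilityForm c) = separabilityForm fun n => φ (c n) := by
  rw [separabilityForm, separabilityForm, map_mul, ← resultant_map_map, ← derivative_map,
    map_vectorPoly]

theorem coeff_vectorPoly_last (c : Fin (I + 1) → R) :
    (vectorPoly c).coeff I = c (Fin.last I) := by
  simp only [vectorPoly, finsetSum_coeff, coeff_C_mul, coeff_X_pow]
  rw [Finset.sum_eq_single (Fin.last I)]
  · simp
  · intro n _ hn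
    have : I ≠ (n : ℕ) := fun h => hn (Fin.ext h.symm)
    simp [this]
  · simp

theorem ncard_roots_of_separabilityForm_ne_zero (hI : 0 < I) {c : Fin (I + 1) → ℂ}
    (hc : separabilityForm c ≠ 0) : {z : ℂ | (formPoly c).IsRoot z}.ncard = I := by
  rw [← vectorPoly_eq_formPoly]
  have hlead : (vectorPoly c).coeff I ≠ 0 := by
    rw [coeff_vectorPoly_last]; exact left_ne_zero_of_mul hc
  have hdeg : (vectorPoly c).natDegree = I :=
    le_antisymm (natDegree_vectorPoly_le c) (le_natDegree_of_ne_zero hlead)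
  have h0 : vectorPoly c ≠ 0 := fun h => hlead (by simp [h])
  have hsep : (vectorPoly c).Separable := by
    obtain ⟨p, q, -, -, hpq⟩ := exists_mul_add_mul_eq_C_resultant (m := I) (n := I - 1)
      (vectorPoly c) (derivative (vectorPoly c)) (natDegree_vectorPoly_le c)
      ((natDegree_derivative_le _).trans (by rw [hdeg])) (Or.inl hI.ne')
    have hr := right_ne_zero_of_mul hc
    refine ⟨C (resultant (vectorPoly c) (derivative (vectorPoly c)) I (I - 1))⁻¹ * p,
      C (resultant (vectorPoly c) (derivative (vectorPoly c)) I (I - 1))⁻¹ * q, ?_⟩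
    rw [mul_assoc, mul_assoc, ← mul_add, mul_comm p, mul_comm q, hpq, ← C_mul,
      inv_mul_cancel₀ hr, C_1]
  have hset : {z : ℂ | (vectorPoly c).IsRoot z} = ((vectorPoly c).roots.toFinset : Set ℂ) := by
    ext z; simp [h0]
  rw [hset, Set.ncard_coe_finset, Multiset.toFinset_card_of_nodup (nodup_roots hsep),
    splits_iff_card_roots.mp (IsAlgClosed.splits _), hdeg]

theorem separabilityForm_ne_zero_of_separable {p : ℂ[X]} (hp : p.Separable)
    (hdeg : p.natDegree = I) : separabilityForm (fun n : Fin (I + 1) => p.coeff n) ≠ 0 := by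
  refine mul_ne_zero ?_ ?_
  · simpa [← hdeg] using hp.ne_zero
  · rw [vectorPoly_coeff hdeg.le]
    have := resultant_ne_zero p (derivative p) hp
    rwa [natDegree_derivative, hdeg] at this

end Separability

/-! ### Discrete functionals and kernel vectors -/

section Atoms

variable {K m I : ℕ} {w α : Fin K → ℂ} {s : Finset ℂ} {ω : ℂ → ℂ}

/-- The functional `f ↦ ∑ k, w k * f (α k)` is supported exactly on the finite set `s`, where it
has the nonzero weights `ω`. The points `α k` may coincide, and their weights then add up. -/
structure HasAtoms (w α : Fin K → ℂ) (s : Finset ℂ) (ω : ℂ → ℂ) : Prop where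
  mem : ∀ k, α k ∈ s
  weight_ne_zero : ∀ x ∈ s, ω x ≠ 0
  sum_eq : ∀ f : ℂ → ℂ, ∑ k, w k * f (α k) = ∑ x ∈ s, ω x * f x

theorem transpose_momentMatrix {J : ℕ} :
    (momentMatrix (J + 1) I w α).transpose = momentMatrix (I + 1) J w α := by
  ext i j
  simp [momentMatrix, add_comm]

theorem HasAtoms.eq_zero_of_transpose_mulVec_eq_zero {J : ℕ} (h : HasAtoms w α s ω)
    (hJ : J + 1 ≤ s.card) (hI : s.card ≤ I + 1) {y : Fin (J + 1) → ℂ}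
    (hy : (momentMatrix (I + 1) J w α).mulVec y = 0) : y = 0 := by
  have heval : ∀ x ∈ s, (vectorPoly y).eval x = 0 := by
    intro x hx
    -- testing against the Lagrange basis polynomial of `x` isolates the value at `x`
    have hdeg : (Lagrange.basis s id x).degree < ((I + 1 : ℕ) : WithBot ℕ) := by
      rw [Lagrange.degree_basis Function.injective_id.injOn hx]
      exact_mod_cast (by have := Finset.card_pos.mpr ⟨x, hx⟩; omega : s.card - 1 < I + 1)
    have h1 := sum_mul_eval_eq_zero_of_mulVec_eq_zero hy hdeg
    rw [h.sum_eq fun z => (Lagrange.basis s id x * vectorPoly y).eval z,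
      Finset.sum_eq_single_of_mem x hx] at h1
    · have h2 := Lagrange.eval_basis_self (v := id) Function.injective_id.injOn hx
      rw [id] at h2
      simpa [h2, h.weight_ne_zero x hx] using h1
    · intro z hz hzx
      have h2 := Lagrange.eval_basis_of_ne (s := s) (v := id) hzx.symm hz
      rw [id] at h2
      simp [h2]
  have hpoly : vectorPoly y = 0 := by
    refine eq_zero_of_degree_lt_of_eval_finset_eq_zero s ?_ heval
    refine (degree_le_of_natDegree_le (natDegree_vectorPoly_le y)).trans_lt ?_
    exact_mod_cast hJ
  funext j
  have hj := congrArg (fun p : ℂ[X] => p.coeff (j : ℕ)) hpoly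
  simp only [vectorPoly, finsetSum_coeff, coeff_C_mul, coeff_X_pow, coeff_zero] at hj
  rw [Finset.sum_eq_single j] at hj
  · simpa using hj
  · intro n _ hn
    have : (j : ℕ) ≠ n := fun h => hn (Fin.ext h.symm)
    simp [this]
  · simp

/-- The moment matrix of a functional with `r` atoms has full row rank if `m ≤ r ≤ I + 1`. -/
theorem HasAtoms.exists_right_inverse (h : HasAtoms w α s ω) (hm : 0 < m) (hs : m ≤ s.card)
    (hI : s.card ≤ I + 1) :
    ∃ W : Matrix (Fin (I + 1)) (Fin m) ℂ, momentMatrix m I w α * W = 1 := by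
  obtain ⟨J, rfl⟩ : ∃ J, m = J + 1 := ⟨m - 1, by omega⟩
  rw [← Matrix.mulVec_surjective_iff_exists_right_inverse]
  have hinj : Function.Injective (momentMatrix (I + 1) J w α).mulVecLin := by
    rw [injective_iff_map_eq_zero]
    exact fun y hy => h.eq_zero_of_transpose_mulVec_eq_zero hs hI hy
  have hrank : (momentMatrix (J + 1) I w α).rank = J + 1 := by
    rw [← Matrix.rank_transpose, transpose_momentMatrix, Matrix.rank,
      LinearMap.finrank_range_of_inj hinj, Module.finrank_fin_fun]
  have htop : LinearMap.range (momentMatrix (J + 1) I w α).mulVecLin = ⊤ :=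
    Submodule.eq_top_of_finrank_eq (by rw [Module.finrank_fin_fun]; exact hrank)
  exact LinearMap.range_eq_top.mp htop

theorem HasAtoms.mulVec_apply (h : HasAtoms w α s ω) (c : Fin (I + 1) → ℂ) (j : Fin m) :
    (momentMatrix m I w α).mulVec c j =
      ∑ x ∈ s, ω x * (x ^ (j : ℕ) * (vectorPoly c).eval x) := by
  rw [momentMatrix_mulVec_apply]
  exact h.sum_eq fun x => x ^ (j : ℕ) * (vectorPoly c).eval x

/-- A polynomial vanishing at all the atoms lies in the kernel, and with at most `I` atoms it can
be completed to a product of `I` distinct linear factors. -/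
theorem HasAtoms.exists_separabilityForm_ne_zero (h : HasAtoms w α s ω) (hI : s.card ≤ I) :
    ∃ c : Fin (I + 1) → ℂ, (momentMatrix m I w α).mulVec c = 0 ∧ separabilityForm c ≠ 0 := by
  obtain ⟨t, hst, ht⟩ := Infinite.exists_superset_card_eq s I hI
  have hdeg : (Lagrange.nodal t id : ℂ[X]).natDegree = I := by rw [Lagrange.natDegree_nodal, ht]
  refine ⟨fun n => (Lagrange.nodal t id).coeff n, ?_, ?_⟩
  · funext j
    rw [h.mulVec_apply, vectorPoly_coeff hdeg.le]
    refine Finset.sum_eq_zero fun x hx => ?_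
    have := Lagrange.eval_nodal_at_node (v := (id : ℂ → ℂ)) (hst hx)
    rw [id] at this
    simp [this]
  · refine separabilityForm_ne_zero_of_separable ?_ hdeg
    rw [Lagrange.nodal_eq, separable_prod_X_sub_C_iff']
    exact fun x _ y _ hxy => hxy

/-- The weights of the divided difference on the atoms annihilate all polynomials of degree less
than `s.card - 1`, and none of them is zero. Prescribing the values of a polynomial so that they
turn `ω` into these weights gives a kernel vector without roots among the atoms. -/
theorem HasAtoms.exists_eval_ne_zero (h : HasAtoms w α s ω) (hm : m < s.card)
    (hI : s.card ≤ I + 1) :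
    ∃ c : Fin (I + 1) → ℂ, (momentMatrix m I w α).mulVec c = 0 ∧
      ∀ k, (vectorPoly c).eval (α k) ≠ 0 := by
  have hid : Set.InjOn (id : ℂ → ℂ) s := Function.injective_id.injOn
  set P : ℂ[X] := Lagrange.interpolate s id fun x => (ω x)⁻¹ * (∏ y ∈ s.erase x, (x - y))⁻¹
    with hP
  have hdeg : P.natDegree ≤ I := by
    refine natDegree_le_of_degree_le ((Lagrange.degree_interpolate_le _ hid).trans ?_)
    exact_mod_cast (by omega : s.card - 1 ≤ I)
  have heval : ∀ x ∈ s, P.eval x = (ω x)⁻¹ * (∏ y ∈ s.erase x, (x - y))⁻¹ := fun x hx =>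
    Lagrange.eval_interpolate_at_node (v := id) _ hid hx
  have hprod : ∀ x ∈ s, ∏ y ∈ s.erase x, (x - y) ≠ 0 := fun x _ =>
    Finset.prod_ne_zero_iff.mpr fun y hy => sub_ne_zero.mpr (Finset.ne_of_mem_erase hy).symm
  refine ⟨fun n => P.coeff n, ?_, fun k => ?_⟩
  · funext j
    have hj : (j : ℕ) < s.card - 1 := by have := j.2; omega
    have hcoeff := Lagrange.coeff_eq_sum (s := s) (v := id) hid (P := (X : ℂ[X]) ^ (j : ℕ))
      (by rw [degree_X_pow]; exact_mod_cast (by omega : (j : ℕ) < s.card))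
    rw [coeff_X_pow, if_neg hj.ne'] at hcoeff
    rw [h.mulVec_apply, vectorPoly_coeff hdeg, Pi.zero_apply, hcoeff]
    refine Finset.sum_congr rfl fun x hx => ?_
    have hω := h.weight_ne_zero x hx
    rw [heval x hx]
    simp only [eval_pow, eval_X, id]
    field_simp
  · rw [vectorPoly_coeff hdeg, heval _ (h.mem k)]
    exact mul_ne_zero (inv_ne_zero (h.weight_ne_zero _ (h.mem k)))
      (inv_ne_zero (hprod _ (h.mem k)))

end Atoms

section Grouping

variable {K : ℕ} {w : Fin K → ℂ}

/-- Exchanging one index for another shows that if all sums of `n` weights vanished, then all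
weights would be equal, hence zero. -/
theorem exists_card_eq_sum_ne_zero (hw : ∀ k, w k ≠ 0) {n : ℕ} (hn : 0 < n) (hnK : n < K) :
    ∃ J : Finset (Fin K), J.card = n ∧ ∑ k ∈ J, w k ≠ 0 := by
  by_contra! hzero
  have heq : ∀ a b, w a = w b := by
    intro a b
    rcases eq_or_ne a b with rfl | hab
    · rfl
    obtain ⟨T, hT, hTc⟩ := Finset.exists_subset_card_eq
      (s := (Finset.univ.erase a).erase b) (n := n - 1) (by
        rw [Finset.card_erase_of_mem (by simp [hab.symm]), Finset.card_erase_of_mem (by simp),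
          Finset.card_univ, Fintype.card_fin]
        omega)
    have haT : a ∉ T := fun h => by simpa using hT h
    have hbT : b ∉ T := fun h => by simpa using hT h
    have h1 := hzero (insert a T) (by rw [Finset.card_insert_of_notMem haT, hTc]; omega)
    have h2 := hzero (insert b T) (by rw [Finset.card_insert_of_notMem hbT, hTc]; omega)
    rw [Finset.sum_insert haT] at h1
    rw [Finset.sum_insert hbT] at h2
    exact add_right_cancel (h1.trans h2.symm)
  obtain ⟨J, -, hJ⟩ := Finset.exists_subset_card_eq (s := (Finset.univ : Finset (Fin K)))
    (n := n) (by rw [Finset.card_univ, Fintype.card_fin]; omega)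
  have h0 := hzero J hJ
  rw [Finset.sum_congr rfl fun k _ => heq k ⟨0, by omega⟩, Finset.sum_const, hJ, nsmul_eq_mul,
    mul_eq_zero] at h0
  rcases h0 with h0 | h0
  · exact hn.ne' (by exact_mod_cast h0)
  · exact hw _ h0

/-- For every `2 ≤ r ≤ K` some choice of points gives a functional with exactly `r` atoms: collapse
`K - r + 1` points whose weights have nonzero sum into one. -/
theorem exists_hasAtoms_card_eq (hw : ∀ k, w k ≠ 0) {r : ℕ} (hr : 2 ≤ r) (hrK : r ≤ K) :
    ∃ (α : Fin K → ℂ) (s : Finset ℂ) (ω : ℂ → ℂ), HasAtoms w α s ω ∧ s.card = r := by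
  classical
  obtain ⟨J, hJ, hsum⟩ := exists_card_eq_sum_ne_zero hw (n := K - r + 1) (by omega) (by omega)
  -- the point `K` differs from all the points `k < K` used for the other indices
  let α : Fin K → ℂ := fun k => if k ∈ J then (K : ℂ) else ((k : ℕ) : ℂ)
  have hne : ∀ k : Fin K, ((k : ℕ) : ℂ) ≠ (K : ℂ) := fun k h =>
    k.2.ne (by exact_mod_cast h)
  have hinj : ∀ k l : Fin K, ((k : ℕ) : ℂ) = ((l : ℕ) : ℂ) → k = l := fun k l h =>
    Fin.ext (by exact_mod_cast h)
  have himage : Finset.univ.image α = insert (K : ℂ) (Jᶜ.image fun k : Fin K => ((k : ℕ) : ℂ)) := by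
    ext x
    simp only [Finset.mem_image, Finset.mem_univ, true_and, Finset.mem_insert, Finset.mem_compl, α]
    constructor
    · rintro ⟨k, rfl⟩
      by_cases hk : k ∈ J
      · simp [hk]
      · exact Or.inr ⟨k, hk, by simp [hk]⟩
    · rintro (rfl | ⟨k, hk, rfl⟩)
      · obtain ⟨k, hk⟩ : J.Nonempty := Finset.card_pos.mp (by omega)
        exact ⟨k, by simp [hk]⟩
      · exact ⟨k, by simp [hk]⟩
  refine ⟨α, Finset.univ.image α, fun x => ∑ k with α k = x, w k, ⟨?_, ?_, ?_⟩, ?_⟩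
  · exact fun k => Finset.mem_image_of_mem α (Finset.mem_univ k)
  · intro x hx
    rw [himage, Finset.mem_insert, Finset.mem_image] at hx
    rcases hx with rfl | ⟨l, hl, rfl⟩
    · have : (Finset.univ.filter fun k => α k = (K : ℂ)) = J := by
        ext k
        by_cases hk : k ∈ J <;> simp [α, hk, k.2.ne]
      rwa [this]
    · have hlJ : l ∉ J := Finset.mem_compl.mp hl
      have : (Finset.univ.filter fun k => α k = ((l : ℕ) : ℂ)) = {l} := by
        ext k
        by_cases hk : k ∈ J
        · have hkl : k ≠ l := fun h => hlJ (h ▸ hk)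
          simp [α, hk, hkl, (hne l).symm]
        · have : ((k : ℕ) : ℂ) = ((l : ℕ) : ℂ) ↔ k = l := ⟨hinj k l, fun h => by rw [h]⟩
          simp only [α, hk, if_false, Finset.mem_filter, Finset.mem_univ, true_and,
            Finset.mem_singleton, this]
      rw [this, Finset.sum_singleton]
      exact hw l
  · intro f
    rw [← Finset.sum_fiberwise_of_maps_to (s := Finset.univ) (t := Finset.univ.image α) (g := α)
      fun k hk => Finset.mem_image_of_mem α hk]
    refine Finset.sum_congr rfl fun x _ => ?_
    rw [Finset.sum_mul]
    refine Finset.sum_congr rfl fun k hk => ?_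
    rw [(Finset.mem_filter.mp hk).2]
  · rw [himage, Finset.card_insert_of_notMem, Finset.card_image_of_injective _ hinj,
      Finset.card_compl, Fintype.card_fin, hJ]
    · omega
    · rw [Finset.mem_image]
      rintro ⟨k, -, hk⟩
      exact hne k hk

end Grouping

/-! ### Genericity of the data points and of the kernel vector -/

section Deformation

variable {K m I : ℕ}

/-- A kernel vector of the moment matrix at points `α₀` where the matrix has full row rank extends
to a kernel vector that depends polynomially on the points. If `W` is a right inverse at `α₀`, then
`det (U W) c₀ - W adj (U W) U c₀` is such an extension. -/
theorem exists_polynomial_mulVec_eq_zero {w α₀ : Fin K → ℂ} {c₀ : Fin (I + 1) → ℂ}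
    {W : Matrix (Fin (I + 1)) (Fin m) ℂ} (hW : momentMatrix m I w α₀ * W = 1)
    (hc₀ : (momentMatrix m I w α₀).mulVec c₀ = 0) :
    ∃ c : Fin (I + 1) → MvPolynomial (Fin K) ℂ,
      (∀ n, MvPolynomial.eval α₀ (c n) = c₀ n) ∧
      ∀ α : Fin K → ℂ, (momentMatrix m I w α).mulVec (fun n => MvPolynomial.eval α (c n)) = 0 := by
  let U : Matrix (Fin m) (Fin (I + 1)) (MvPolynomial (Fin K) ℂ) :=
    momentMatrix m I (fun k => MvPolynomial.C (w k)) fun k => MvPolynomial.X k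
  let W' : Matrix (Fin (I + 1)) (Fin m) (MvPolynomial (Fin K) ℂ) := W.map MvPolynomial.C
  let v : Fin (I + 1) → MvPolynomial (Fin K) ℂ := fun n => MvPolynomial.C (c₀ n)
  let c : Fin (I + 1) → MvPolynomial (Fin K) ℂ :=
    (U * W').det • v - W'.mulVec ((U * W').adjugate.mulVec (U.mulVec v))
  have hU : ∀ α : Fin K → ℂ, U.map (MvPolynomial.eval α) = momentMatrix m I w α := fun α => by
    simp only [U, map_momentMatrix, MvPolynomial.eval_C, MvPolynomial.eval_X]
  have hUc : U.mulVec c = 0 := by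
    rw [Matrix.mulVec_sub, Matrix.mulVec_smul, Matrix.mulVec_mulVec, Matrix.mulVec_mulVec,
      Matrix.mul_adjugate, Matrix.smul_mulVec, Matrix.one_mulVec, sub_self]
  refine ⟨c, fun n => ?_, fun α => ?_⟩
  · have hW' : W'.map (MvPolynomial.eval α₀) = W := by
      ext i j; simp [W']
    have hdet : MvPolynomial.eval α₀ (U * W').det = 1 := by
      rw [RingHom.map_det, RingHom.mapMatrix_apply, Matrix.map_mul, hU, hW', hW, Matrix.det_one]
    have hv : (MvPolynomial.eval α₀) ∘ v = c₀ := by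
      funext n; simp [v]
    have hUv : (MvPolynomial.eval α₀) ∘ (U.mulVec v) = 0 := by
      funext j
      rw [Function.comp_apply, RingHom.map_mulVec, hU, hv, hc₀]
    have hadj : (MvPolynomial.eval α₀) ∘ ((U * W').adjugate.mulVec (U.mulVec v)) = 0 := by
      funext j
      rw [Function.comp_apply, RingHom.map_mulVec, hUv, Matrix.mulVec_zero]
    simp only [c, Pi.sub_apply, Pi.smul_apply, smul_eq_mul, map_sub, map_mul, hdet,
      RingHom.map_mulVec, hadj, Matrix.mulVec_zero, Pi.zero_apply, sub_zero, one_mul]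
    exact congrFun hv n
  · funext j
    have := RingHom.map_mulVec (MvPolynomial.eval α) U c j
    rw [hUc, hU, Pi.zero_apply, map_zero] at this
    exact this.symm

/-- For data points outside a hypersurface, the kernel of the moment matrix contains a separable
polynomial of degree `I`, and it contains a polynomial without roots among the data points. -/
theorem exists_generic_kernel_vectors {w : Fin K → ℂ} (hw : ∀ k, w k ≠ 0) (hK : 2 ≤ K)
    (hI : 2 ≤ I) (hm : 0 < m) (hmI : m ≤ I) (hmK : m < K) :
    ∃ Φ : MvPolynomial (Fin K) ℂ, Φ ≠ 0 ∧ ∀ α : Fin K → ℂ, MvPolynomial.eval α Φ ≠ 0 →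
      (∃ c : Fin (I + 1) → ℂ, (momentMatrix m I w α).mulVec c = 0 ∧ separabilityForm c ≠ 0) ∧
      ∃ c : Fin (I + 1) → ℂ, (momentMatrix m I w α).mulVec c = 0 ∧
        ∀ k, (vectorPoly c).eval (α k) ≠ 0 := by
  -- `min K I` atoms leave room for a polynomial of degree `I` vanishing at all of them
  obtain ⟨α₁, s₁, ω₁, h₁, hs₁⟩ := exists_hasAtoms_card_eq hw (r := min K I) (by omega) (by omega)
  -- `min K (I + 1)` atoms are more than `m`, and few enough to be interpolated in degree `I`
  obtain ⟨α₂, s₂, ω₂, h₂, hs₂⟩ := exists_hasAtoms_card_eq hw (r := min K (I + 1)) (by omega)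
    (by omega)
  obtain ⟨W₁, hW₁⟩ := h₁.exists_right_inverse (I := I) hm (by omega) (by omega)
  obtain ⟨W₂, hW₂⟩ := h₂.exists_right_inverse (I := I) hm (by omega) (by omega)
  obtain ⟨a₁, ha₁, hne₁⟩ := h₁.exists_separabilityForm_ne_zero (m := m) (I := I) (by omega)
  obtain ⟨a₂, ha₂, hne₂⟩ := h₂.exists_eval_ne_zero (m := m) (I := I) (by omega) (by omega)
  obtain ⟨c₁, hc₁, hker₁⟩ := exists_polynomial_mulVec_eq_zero hW₁ ha₁
  obtain ⟨c₂, hc₂, hker₂⟩ := exists_polynomial_mulVec_eq_zero hW₂ ha₂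
  have heval₁ : ∀ α : Fin K → ℂ, MvPolynomial.eval α (separabilityForm c₁) =
      separabilityForm fun n => MvPolynomial.eval α (c₁ n) :=
    fun α => map_separabilityForm _ _
  have heval₂ : ∀ α : Fin K → ℂ,
      MvPolynomial.eval α (∏ k, (vectorPoly c₂).eval (MvPolynomial.X k)) =
        ∏ k, (vectorPoly fun n => MvPolynomial.eval α (c₂ n)).eval (α k) := by
    intro α
    rw [map_prod]
    refine Finset.prod_congr rfl fun k _ => ?_
    simp [eval_vectorPoly]
  refine ⟨separabilityForm c₁ * ∏ k, (vectorPoly c₂).eval (MvPolynomial.X k),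
    mul_ne_zero ?_ ?_, fun α hα => ?_⟩
  · intro h0
    apply hne₁
    have := heval₁ α₁
    simp only [h0, map_zero, hc₁] at this
    exact this.symm
  · intro h0
    have := heval₂ α₂
    simp only [h0, map_zero, hc₂] at this
    exact Finset.prod_ne_zero_iff.mpr (fun k _ => hne₂ k) this.symm
  · rw [map_mul, heval₁, heval₂] at hα
    exact ⟨⟨_, hker₁ α, left_ne_zero_of_mul hα⟩, ⟨_, hker₂ α, fun k =>
      Finset.prod_ne_zero_iff.mp (right_ne_zero_of_mul hα) k (Finset.mem_univ k)⟩⟩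

end Deformation

section KernelVector

/-- If each of two polynomials is nonzero somewhere on the kernel of a matrix, so is their product:
restricted to the line through the two points, both are nonzero polynomials in one variable. -/
theorem exists_mulVec_eq_zero_eval_mul_ne_zero {m n : ℕ} {U : Matrix (Fin m) (Fin n) ℂ}
    {a b : Fin n → ℂ} (ha : U.mulVec a = 0) (hb : U.mulVec b = 0) {Ψ₁ Ψ₂ : MvPolynomial (Fin n) ℂ}
    (h₁ : MvPolynomial.eval a Ψ₁ ≠ 0) (h₂ : MvPolynomial.eval b Ψ₂ ≠ 0) :
    ∃ c, U.mulVec c = 0 ∧ MvPolynomial.eval c (Ψ₁ * Ψ₂) ≠ 0 := by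
  let line : MvPolynomial (Fin n) ℂ →+* ℂ[X] :=
    MvPolynomial.eval₂Hom C fun i => C (a i) + X * C (b i - a i)
  have hline : ∀ (t : ℂ) (Ψ : MvPolynomial (Fin n) ℂ),
      (line Ψ).eval t = MvPolynomial.eval (a + t • (b - a)) Ψ := by
    intro t Ψ
    have : (evalRingHom t).comp line = MvPolynomial.eval (a + t • (b - a)) := by
      ext i
      · simp [line]
      · simp [line]
    exact congrArg (fun φ : MvPolynomial (Fin n) ℂ →+* ℂ => φ Ψ) this
  have hne₁ : line Ψ₁ ≠ 0 := fun h0 => h₁ (by simpa [h0] using (hline 0 Ψ₁).symm)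
  have hne₂ : line Ψ₂ ≠ 0 := fun h0 => h₂ (by simpa [h0] using (hline 1 Ψ₂).symm)
  obtain ⟨t, ht⟩ : ∃ t, (line (Ψ₁ * Ψ₂)).eval t ≠ 0 := by
    by_contra! hall
    exact mul_ne_zero hne₁ hne₂ (by rw [← map_mul]; exact Polynomial.funext (by simpa using hall))
  refine ⟨a + t • (b - a), ?_, by rwa [← hline]⟩
  rw [Matrix.mulVec_add, Matrix.mulVec_smul, Matrix.mulVec_sub, ha, hb]
  simp

/-- Having admissible roots is a nonempty open condition on the kernel as soon as the kernel
contains a separable polynomial of degree `I` and one without roots among the data points. -/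
theorem exists_polynomial_hasAdmissibleRoots {K m I : ℕ} {α : Fin K → ℂ}
    {U : Matrix (Fin m) (Fin (I + 1)) ℂ} (hI : 0 < I)
    (hsep : ∃ c, U.mulVec c = 0 ∧ separabilityForm c ≠ 0)
    (hdata : ∃ c, U.mulVec c = 0 ∧ ∀ k, (vectorPoly c).eval (α k) ≠ 0) :
    ∃ Ψ : MvPolynomial (Fin (I + 1)) ℂ,
      (∃ c, U.mulVec c = 0 ∧ MvPolynomial.eval c Ψ ≠ 0) ∧
      ∀ c, U.mulVec c = 0 → MvPolynomial.eval c Ψ ≠ 0 → c ≠ 0 ∧ HasAdmissibleRoots α c := by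
  obtain ⟨a, ha, ha'⟩ := hsep
  obtain ⟨b, hb, hb'⟩ := hdata
  let Ψ₁ : MvPolynomial (Fin (I + 1)) ℂ := separabilityForm MvPolynomial.X
  let Ψ₂ : MvPolynomial (Fin (I + 1)) ℂ :=
    ∏ k, (vectorPoly MvPolynomial.X).eval (MvPolynomial.C (α k))
  have heval₁ : ∀ c, MvPolynomial.eval c Ψ₁ = separabilityForm c := fun c => by
    rw [map_separabilityForm]
    simp only [MvPolynomial.eval_X]
  have heval₂ : ∀ c, MvPolynomial.eval c Ψ₂ = ∏ k, (vectorPoly c).eval (α k) := fun c => by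
    rw [map_prod]
    exact Finset.prod_congr rfl fun k _ => by simp [eval_vectorPoly]
  refine ⟨Ψ₁ * Ψ₂, exists_mulVec_eq_zero_eval_mul_ne_zero ha hb (by rwa [heval₁])
    (by rw [heval₂]; exact Finset.prod_ne_zero_iff.mpr fun k _ => hb' k), fun c _ hc => ?_⟩
  rw [map_mul, heval₁, heval₂] at hc
  have hc₁ := left_ne_zero_of_mul hc
  refine ⟨?_, ncard_roots_of_separabilityForm_ne_zero hI hc₁, fun k =>
    Finset.prod_ne_zero_iff.mp (right_ne_zero_of_mul hc) k (Finset.mem_univ k)⟩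
  rintro rfl
  exact hc₁ (by simp [separabilityForm])

end KernelVector

/-! ### Feasibility of the construction -/

section Feasibility

theorem nodal_dvd_of_eval_eq_zero {ι : Type*} {T : Finset ι} {β : ι → ℂ} (hβ : Set.InjOn β T)
    {p : ℂ[X]} (hp : ∀ n ∈ T, p.eval (β n) = 0) : Lagrange.nodal T β ∣ p := by
  rw [Lagrange.nodal_eq]
  refine Finset.prod_dvd_of_coprime (fun a ha b hb hab => ?_) fun n hn =>
    dvd_iff_isRoot.mpr (hp n hn)
  exact isCoprime_X_sub_C_of_isUnit_sub (sub_ne_zero.mpr fun h => hab (hβ ha hb h)).isUnit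

/-- The error of interpolating `G` at the nodes indexed by `T` is a multiple of the nodal
polynomial of `T`, with a cofactor of the expected degree. -/
theorem exists_sub_interpolate_eq_nodal_mul {ι : Type*} [DecidableEq ι] {T : Finset ι} {β : ι → ℂ}
    (hβ : Set.InjOn β T) {G : ℂ[X]} {D : ℕ} (hG : G.natDegree ≤ D) (hT : T.card ≤ D) :
    ∃ Q : ℂ[X], G - Lagrange.interpolate T β (fun n => G.eval (β n)) = Lagrange.nodal T β * Q ∧
      Q.natDegree ≤ D - T.card := by
  obtain ⟨Q, hQ⟩ := nodal_dvd_of_eval_eq_zero hβ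
    (p := G - Lagrange.interpolate T β fun n => G.eval (β n)) fun n hn => by
      rw [eval_sub, Lagrange.eval_interpolate_at_node _ hβ hn, sub_self]
  refine ⟨Q, hQ, ?_⟩
  rcases eq_or_ne Q 0 with rfl | hQ0
  · simp
  have hint : (Lagrange.interpolate T β fun n => G.eval (β n)).natDegree ≤ D :=
    (natDegree_le_of_degree_le (Lagrange.degree_interpolate_le _ hβ)).trans (by omega)
  have hdeg := natDegree_sub_le_of_le hG hint
  rw [hQ, natDegree_mul Lagrange.nodal_ne_zero hQ0, Lagrange.natDegree_nodal] at hdeg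
  omega

variable {K N S : ℕ} {𝒩 : NonStragglerPattern N S} {α : Fin K → ℂ}
  {c : Fin (𝒩.interCard + 1) → ℂ} {β : Fin N → ℂ}

theorem NonStragglerPattern.inter_subset {T : Finset (Fin N)} (hT : T ∈ 𝒩.sets) : 𝒩.inter ⊆ T :=
  fun _ hn => (Finset.mem_filter.mp hn).2 T hT

theorem NonStragglerPattern.interCard_le (𝒩 : NonStragglerPattern N S) : 𝒩.interCard ≤ N - S := by
  obtain ⟨T, hT⟩ := 𝒩.nonempty
  exact 𝒩.card_eq T hT ▸ Finset.card_le_card (inter_subset hT)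

theorem IsConstructedFrom.injOn_inter (hβ : IsConstructedFrom 𝒩 α c β)
    (hc : HasAdmissibleRoots α c) : Set.InjOn β 𝒩.inter := by
  refine Set.injOn_of_ncard_image_eq ?_ (Finset.finite_toSet _)
  rw [hβ.roots, hc.1, Set.ncard_coe_finset, NonStragglerPattern.interCard]

theorem IsConstructedFrom.isRoot (hβ : IsConstructedFrom 𝒩 α c β) {n : Fin N}
    (hn : n ∈ 𝒩.inter) : (formPoly c).IsRoot (β n) := by
  have : β n ∈ {z : ℂ | (formPoly c).IsRoot z} := hβ.roots ▸ Set.mem_image_of_mem β hn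
  exact this

theorem IsConstructedFrom.injective (hβ : IsConstructedFrom 𝒩 α c β)
    (hc : HasAdmissibleRoots α c) : Function.Injective β := by
  intro a b hab
  by_cases ha : a ∈ 𝒩.inter <;> by_cases hb : b ∈ 𝒩.inter
  · exact hβ.injOn_inter hc ha hb hab
  · exact (hβ.rest_ne_root b hb (hab ▸ hβ.isRoot ha)).elim
  · exact (hβ.rest_ne_root a ha (hab ▸ hβ.isRoot hb)).elim
  · exact hβ.rest_injOn ha hb hab

theorem IsConstructedFrom.data_ne_eval (hβ : IsConstructedFrom 𝒩 α c β)
    (hc : HasAdmissibleRoots α c) (k : Fin K) (n : Fin N) : α k ≠ β n := by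
  intro h
  by_cases hn : n ∈ 𝒩.inter
  · exact hc.2 k (h ▸ hβ.isRoot hn)
  · exact hβ.rest_ne_data n hn k h.symm

theorem IsConstructedFrom.exists_formPoly_eq (hβ : IsConstructedFrom 𝒩 α c β)
    (hc : HasAdmissibleRoots α c) (hpos : 0 < 𝒩.interCard) :
    ∃ a : ℂ, a ≠ 0 ∧ formPoly c = Lagrange.nodal 𝒩.inter β * C a := by
  have h0 : formPoly c ≠ 0 := by
    -- every number is a root of the zero polynomial, and `ncard` of an infinite set is `0`
    intro h
    have h1 := hc.1
    simp only [h, IsRoot, eval_zero, Set.ofPred_true] at h1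
    rw [Set.infinite_univ.ncard] at h1
    omega
  obtain ⟨g, hg⟩ := nodal_dvd_of_eval_eq_zero (hβ.injOn_inter hc) (p := formPoly c)
    fun n hn => hβ.isRoot hn
  have hg0 : g ≠ 0 := fun h => h0 (by rw [hg, h, mul_zero])
  have hdeg : (formPoly c).natDegree ≤ 𝒩.interCard := natDegree_vectorPoly_le c
  rw [hg, natDegree_mul Lagrange.nodal_ne_zero hg0, Lagrange.natDegree_nodal,
    NonStragglerPattern.interCard] at hdeg
  have hgC := eq_C_of_natDegree_eq_zero (p := g) (by omega)
  refine ⟨g.coeff 0, fun h => hg0 (by rw [hgC, h, C_0]), ?_⟩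
  rw [← hgC, hg]

/-- For each non-straggler set, the interpolation error is `P_form` times a polynomial of degree
less than the number of rows of the moment matrix, so its weighted sum over the data points is
zero. -/
theorem IsConstructedFrom.sum_mul_eval_interpolate_eq {w : Fin K → ℂ} {D m : ℕ}
    (hβ : IsConstructedFrom 𝒩 α c β) (hc : HasAdmissibleRoots α c) (hpos : 0 < 𝒩.interCard)
    (hm : m + 𝒩.interCard = D + 1) (hND : N - S ≤ D)
    (hker : (momentMatrix m 𝒩.interCard w α).mulVec c = 0)
    {G : ℂ[X]} (hG : G.natDegree ≤ D) {T : Finset (Fin N)} (hT : T ∈ 𝒩.sets) :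
    ∑ k, w k * (Lagrange.interpolate T β fun n => G.eval (β n)).eval (α k) =
      ∑ k, w k * G.eval (α k) := by
  have hcard := 𝒩.card_eq T hT
  obtain ⟨Q, hQ, hQdeg⟩ := exists_sub_interpolate_eq_nodal_mul
    ((hβ.injective hc).injOn (s := T)) hG (hcard.trans_le hND)
  obtain ⟨a, ha, hform⟩ := hβ.exists_formPoly_eq hc hpos
  have hsplit : Lagrange.nodal T β =
      Lagrange.nodal (T \ 𝒩.inter) β * Lagrange.nodal 𝒩.inter β := by
    simp only [Lagrange.nodal_eq]
    exact (Finset.prod_sdiff (NonStragglerPattern.inter_subset hT)).symm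
  have hdeg : (Lagrange.nodal (T \ 𝒩.inter) β * Q).degree < m := by
    refine (degree_le_of_natDegree_le (natDegree_mul_le_of_le
      (Lagrange.natDegree_nodal (s := T \ 𝒩.inter) (v := β)).le hQdeg)).trans_lt ?_
    have hsub := Finset.card_sdiff_of_subset (NonStragglerPattern.inter_subset hT)
    have hle := 𝒩.interCard_le
    rw [NonStragglerPattern.interCard] at hm hle
    exact_mod_cast (by omega : (T \ 𝒩.inter).card + (D - T.card) < m)
  have horth := sum_mul_eval_eq_zero_of_mulVec_eq_zero hker hdeg
  have herr : ∀ x, (Lagrange.nodal (T \ 𝒩.inter) β * Q * vectorPoly c).eval x =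
      a * (G.eval x - (Lagrange.interpolate T β fun n => G.eval (β n)).eval x) := by
    intro x
    rw [← eval_sub, hQ, hsplit, vectorPoly_eq_formPoly, hform]
    simp only [eval_mul, eval_C]
    ring
  simp only [herr, mul_left_comm _ a, ← Finset.mul_sum, mul_sub,
    Finset.sum_sub_distrib] at horth
  exact (mul_left_cancel₀ ha (sub_eq_zero.mp horth)).symm

theorem IsConstructedFrom.isFeasible {d m : ℕ} {w : Fin K → ℂ} (hα : Function.Injective α)
    (hβ : IsConstructedFrom 𝒩 α c β) (hc : HasAdmissibleRoots α c) (hpos : 0 < 𝒩.interCard)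
    (hm : m + 𝒩.interCard = d * (K - 1) + 1) (hND : N - S ≤ d * (K - 1))
    (hker : (momentMatrix m 𝒩.interCard w α).mulVec c = 0) : IsFeasible d w α β 𝒩 where
  data_injective := hα
  eval_injective := hβ.injective hc
  disjoint := hβ.data_ne_eval hc
  recovery := by
    intro q v X F hF T hT
    ext a b
    have hdeg : (F.comp (encoder α X a b)).natDegree ≤ d * (K - 1) := by
      refine natDegree_comp_le.trans (hF ▸ Nat.mul_le_mul_left _ ?_)
      refine natDegree_le_of_degree_le ?_
      simpa [encoder] using
        Lagrange.degree_interpolate_le (s := Finset.univ) (fun k => X k a b) hα.injOn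
    have hsum := hβ.sum_mul_eval_interpolate_eq hc hpos hm hND hker hdeg hT
    have hdata : ∀ k, (encoder α X a b).eval (α k) = X k a b := fun k =>
      Lagrange.eval_interpolate_at_node _ hα.injOn (Finset.mem_univ k)
    simp only [eval_comp, hdata] at hsum
    simpa [decodedOutput, aggregation, decoder, response, Matrix.sum_apply] using hsum

/-- The roots are matched with the workers in the intersection, and the other workers receive
distinct points of the complement of the finitely many forbidden values. -/
theorem HasAdmissibleRoots.exists_isConstructedFrom (hc : HasAdmissibleRoots α c)
    (hpos : 0 < 𝒩.interCard) : ∃ β : Fin N → ℂ, IsConstructedFrom 𝒩 α c β := by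
  classical
  set Z : Set ℂ := {z : ℂ | (formPoly c).IsRoot z} with hZ
  have hZfin : Z.Finite := Set.finite_of_ncard_pos (by rw [hc.1]; exact hpos)
  have := hZfin.fintype
  have hcardZ : Fintype.card 𝒩.inter = Fintype.card Z := by
    rw [Fintype.card_coe, ← Nat.card_eq_fintype_card (α := Z), Nat.card_coe_set_eq, hc.1,
      NonStragglerPattern.interCard]
  let e : 𝒩.inter ≃ Z := Fintype.equivOfCardEq hcardZ
  have : Infinite ↥(Z ∪ Set.range α)ᶜ :=
    (hZfin.union (Set.finite_range α)).infinite_compl.to_subtype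
  let γ : ℕ ↪ ↥(Z ∪ Set.range α)ᶜ := Infinite.natEmbedding _
  have hγ : ∀ n, (γ n : ℂ) ∉ Z ∧ ∀ k, (γ n : ℂ) ≠ α k := fun n =>
    ⟨fun h => (γ n).2 (Or.inl h), fun k h => (γ n).2 (Or.inr ⟨k, h.symm⟩)⟩
  let β : Fin N → ℂ := fun n => if h : n ∈ 𝒩.inter then (e ⟨n, h⟩ : ℂ) else (γ n : ℂ)
  have hin : ∀ n (h : n ∈ 𝒩.inter), β n = e ⟨n, h⟩ := fun n h => dif_pos h
  have hout : ∀ n ∉ 𝒩.inter, β n = γ n := fun n h => dif_neg h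
  refine ⟨β, ⟨?_, ?_, fun n hn => ?_, fun n hn k => ?_⟩⟩
  · ext z
    constructor
    · rintro ⟨n, hn, rfl⟩
      rw [hin n hn]
      exact (e ⟨n, hn⟩).2
    · intro hz
      refine ⟨e.symm ⟨z, hz⟩, (e.symm ⟨z, hz⟩).2, ?_⟩
      rw [hin _ (e.symm ⟨z, hz⟩).2]
      simp
  · intro a ha b hb hab
    rw [hout a ha, hout b hb] at hab
    exact Fin.ext (γ.injective (Subtype.ext hab))
  · rw [hout n hn]; exact (hγ n).1
  · rw [hout n hn]; exact (hγ n).2 k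

end Feasibility

/-! ### Genericity over all patterns -/

section Threshold

/-- The numerical constraints at the threshold, with `m = d (K - 1) + 1 - I` rows. -/
theorem bounds_of_sufficientThreshold_le {K d n I : ℕ} (hd : 0 < d) (hn : 2 ≤ n)
    (hnd : n ≤ d * (K - 1)) (hI : sufficientThreshold K d ≤ I) (hIn : I ≤ n) :
    2 ≤ K ∧ 2 ≤ I ∧ 0 < d * (K - 1) + 1 - I ∧ d * (K - 1) + 1 - I ≤ I ∧
      d * (K - 1) + 1 - I < K := by
  unfold sufficientThreshold at hI
  split_ifs at hI with h1
  · subst h1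
    omega
  · obtain ⟨e, rfl⟩ : ∃ e, d = e + 2 := ⟨d - 2, by omega⟩
    have hK : 2 ≤ K := by
      by_contra h
      have : K - 1 = 0 := by omega
      rw [this] at hnd
      omega
    obtain ⟨x, rfl⟩ : ∃ x, K = x + 2 := ⟨K - 2, by omega⟩
    have e1 : e + 2 - 1 = e + 1 := by omega
    have e2 : x + 2 - 1 = x + 1 := by omega
    rw [e1, e2] at hI
    rw [e2] at hnd ⊢
    have h2 : (e + 2) * (x + 1) = (e + 1) * (x + 1) + (x + 1) := by ring
    have h3 : x + 1 ≤ (e + 1) * (x + 1) := Nat.le_mul_of_pos_left _ (by omega)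
    omega

/-- The condition on the data points depends on the pattern only through the size `I` of the
intersection, which takes finitely many values, so the product of the polynomials of
`exists_generic_kernel_vectors` serves for all patterns. -/
theorem exists_generic_kernel_vectors_of_le {K d n : ℕ} (hd : 0 < d) (hn : 2 ≤ n)
    (hnd : n ≤ d * (K - 1)) {w : Fin K → ℂ} (hw : ∀ k, w k ≠ 0) :
    ∃ Φ : MvPolynomial (Fin K) ℂ, Φ ≠ 0 ∧ ∀ α : Fin K → ℂ, MvPolynomial.eval α Φ ≠ 0 →
      ∀ I m : ℕ, sufficientThreshold K d ≤ I → I ≤ n → m + I = d * (K - 1) + 1 →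
      (∃ c : Fin (I + 1) → ℂ, (momentMatrix m I w α).mulVec c = 0 ∧ separabilityForm c ≠ 0) ∧
      ∃ c : Fin (I + 1) → ℂ, (momentMatrix m I w α).mulVec c = 0 ∧
        ∀ k, (vectorPoly c).eval (α k) ≠ 0 := by
  have hex : ∀ I : ℕ, ∃ Φ : MvPolynomial (Fin K) ℂ, Φ ≠ 0 ∧
      (sufficientThreshold K d ≤ I → I ≤ n → ∀ α : Fin K → ℂ, MvPolynomial.eval α Φ ≠ 0 →
        ∀ m : ℕ, m + I = d * (K - 1) + 1 →
        (∃ c : Fin (I + 1) → ℂ, (momentMatrix m I w α).mulVec c = 0 ∧ separabilityForm c ≠ 0) ∧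
        ∃ c : Fin (I + 1) → ℂ, (momentMatrix m I w α).mulVec c = 0 ∧
          ∀ k, (vectorPoly c).eval (α k) ≠ 0) := by
    intro I
    by_cases h : sufficientThreshold K d ≤ I ∧ I ≤ n
    · obtain ⟨hK, hI, hm, hmI, hmK⟩ := bounds_of_sufficientThreshold_le hd hn hnd h.1 h.2
      obtain ⟨Φ, hΦ, hΦα⟩ := exists_generic_kernel_vectors hw hK hI hm hmI hmK
      refine ⟨Φ, hΦ, fun _ _ α hα m hmeq => ?_⟩
      obtain rfl : m = d * (K - 1) + 1 - I := by omega
      exact hΦα α hα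
    · exact ⟨1, one_ne_zero, fun h1 h2 => (h ⟨h1, h2⟩).elim⟩
  choose Φ hΦ hΦα using hex
  refine ⟨∏ I ∈ Finset.range (n + 1), Φ I, Finset.prod_ne_zero_iff.mpr fun I _ => hΦ I,
    fun α hα I m hI hIn hm => hΦα I hI hIn α ?_ m hm⟩
  rw [map_prod] at hα
  exact Finset.prod_ne_zero_iff.mp hα I (Finset.mem_range.mpr (by omega))

end Threshold

theorem mainTheorem4 (K d S N : ℕ) (hK : 0 < K) (hd : 0 < d) (hS : 0 < S)
    (hN₁ : S + 2 ≤ N) (hN₂ : N ≤ d * (K - 1) + S)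
    (w : Fin K → ℂ) (hw : ∀ k, w k ≠ 0) :
    -- the data points are generic: outside a proper variety fixed by `K`, `N`, `d`, `S`, `w`
    ∃ Φ : MvPolynomial (Fin K) ℂ, Φ ≠ 0 ∧
      ∀ 𝒩 : NonStragglerPattern N S, sufficientThreshold K d ≤ 𝒩.interCard →
      ∀ α : Fin K → ℂ, Function.Injective α → MvPolynomial.eval α Φ ≠ 0 →
      ∀ U : Matrix (Fin (deficit K d S N + 𝒩.gap)) (Fin (𝒩.interCard + 1)) ℂ,
        U = constructionMatrix (deficit K d S N + 𝒩.gap) 𝒩.interCard w α →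
        -- a generic kernel vector is nonzero and yields admissible roots
        (∃ Ψ : MvPolynomial (Fin (𝒩.interCard + 1)) ℂ,
          (∃ c, U.mulVec c = 0 ∧ MvPolynomial.eval c Ψ ≠ 0) ∧
          ∀ c, U.mulVec c = 0 → MvPolynomial.eval c Ψ ≠ 0 →
            c ≠ 0 ∧ HasAdmissibleRoots α c) ∧
        -- from each such vector the construction can be completed, and every completion is feasible
        (∀ c, U.mulVec c = 0 → c ≠ 0 → HasAdmissibleRoots α c →
          (∃ β : Fin N → ℂ, IsConstructedFrom 𝒩 α c β) ∧
          ∀ β : Fin N → ℂ, IsConstructedFrom 𝒩 α c β → IsFeasible d w α β 𝒩) := by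
  have hn : 2 ≤ N - S := by omega
  have hnd : N - S ≤ d * (K - 1) := by omega
  obtain ⟨Φ, hΦ, hgeneric⟩ := exists_generic_kernel_vectors_of_le hd hn hnd hw
  refine ⟨Φ, hΦ, ?_⟩
  rintro 𝒩 hI α hα hαΦ U rfl
  have hle := 𝒩.interCard_le
  have hm : deficit K d S N + 𝒩.gap + 𝒩.interCard = d * (K - 1) + 1 := by
    rw [deficit, NonStragglerPattern.gap]
    omega
  have hpos : 0 < 𝒩.interCard := by
    have := (bounds_of_sufficientThreshold_le hd hn hnd hI hle).2.1
    omega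
  obtain ⟨hsep, hdata⟩ := hgeneric α hαΦ _ _ hI hle hm
  rw [← momentMatrix_eq_constructionMatrix]
  exact ⟨exists_polynomial_hasAdmissibleRoots hpos hsep hdata, fun c hker _ hc =>
    ⟨hc.exists_isConstructedFrom hpos, fun β hβ =>
      hβ.isFeasible hα hc hpos hm hnd hker⟩⟩
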